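/- Let $q$ be an indeterminate, let $(z)_k=\prod_{i=0}^{k-1}(1-zq^i)$, and let $\begin{bmatrix} N\\ m\end{bmatrix}_q=\frac{(q)_N}{(q)_m(q)_{N-m}}$ for $0\le m\le N$ and $0$ otherwise. For a sequence $a=(a_1,\dots,a_n)$ of positive integers put $|a|=a_1+\cdots+a_n$, $\sigma_i=a_1+\cdots+a_i$ and \[x^{(a)}=(x_1,x_1q,\dots,x_1q^{a_1-1},\dots,x_n,x_nq,\dots,x_nq^{a_n-1}).\] For $v=(v_1,\dots,v_n)$ a sequence of nonnegative integers and $\mu$ a partition with at most $|a|$ parts, let \[D_{v,\mu}(a)=\mathrm{CT}\bigg[x^{-v}\,s_\mu\big(x^{(a)}\big)\prod_{1\le i<j\le n}(x_i/x_j)_{a_i}(qx_j/x_i)_{a_j}\bigg],\] where $\mathrm{CT}$ denotes the constant term of a Laurent polynomial in $x_1,\dots,x_n$ over $\mathbb{Q}(q)$, $x^{-v}=x_1^{-v_1}\cdots x_n^{-v_n}$, and $s_\mu(y_1,\dots,y_N)=\det(y_i^{\mu_j+N-j})_{1\le i,j\le N}/\prod_{1\le i<j\le N}(y_i-y_j)$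 is the Schur function (with $N=|a|$, $\mu$ being extended by zeros to length $N$). Write $D_v(a)=D_{v,v^+}(a)$, where $v^+$ is the weakly decreasing rearrangement of $v$. For $w\in\mathfrak{S}_n$ and a sequence $b$ of length $n$ let $w(b)=(b_{w(1)},\dots,b_{w(n)})$, and let $R(w)=\{(i,j): 1\le i<j\le n,\ w^{-1}(i)>w^{-1}(j)\}$. Let $\lambda=(\lambda_1,\dots,\lambda_n)$ be a strict partition, i.e., integers $\lambda_1>\lambda_2>\cdots>\lambda_n\ge 0$, and set $\bar\lambda=(\lambda_n,\dots,\lambda_1)$. Then, for all positive integers $a_1,\dots,a_n$ and all $w\in\mathfrak{S}_n$, \[D_{w^{-1}(\bar\lambda)}(a)=w\bigg(\prod_{i=1}^n\begin{bmatrix}\bar\lambda_i+\sigma_i-1\\ a_i-1\end{bmatrix}_q\bigg)\,q^{\sum_{(i,j)\in R(w)}a_j},\] where $w$ acts on the product by permuting the $a_i$ only, i.e., \[w\bigg(\prod_{i=1}^n\begin{bmatrix}\bar\lambda_i+\sigma_i-1\\ a_i-1\end{bmatrix}_q\bigg) =\prod_{i=1}^n\begin{bmatrix}\bar\lambda_i+a_{w(1)}+\cdots+a_{w(i)}-1\\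 a_{w(i)}-1\end{bmatrix}_q.\] In particular, \[D_{\lambda,\lambda}(a)=q^{\sum_{1\le i<j\le n}a_j}\prod_{i=1}^n\begin{bmatrix}\lambda_i+a_i+\cdots+a_n-1\\ a_i-1\end{bmatrix}_q.\] -/

import Mathlib

namespace QDyson

noncomputable section

/-- The set of pairs `(i, j)` with `1 ≤ i < j ≤ n`. -/
def pairs (n : ℕ) : Finset (Fin n × Fin n) :=
  Finset.univ.filter fun p => p.1 < p.2

/-- The inversion set `I(w)` of a permutation: pairs `i < j` with `w(i) > w(j)`. -/
def inversionSet {n : ℕ} (w : Equiv.Perm (Fin n)) : Finset (Fin n × Fin n) :=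
  (pairs n).filter fun p => w p.2 < w p.1

/-- `R(w) = I(w⁻¹)`. -/
def R {n : ℕ} (w : Equiv.Perm (Fin n)) : Finset (Fin n × Fin n) :=
  inversionSet w⁻¹

/-- The partial sum `σ_i = a_1 + ⋯ + a_i`. -/
def partialSum {n : ℕ} (a : Fin n → ℕ) (i : Fin n) : ℕ :=
  ∑ k ∈ Finset.Iic i, a k

/-- The reversal `(v_n, …, v_1)` of a sequence `(v_1, …, v_n)`. -/
def bar {n : ℕ} (v : Fin n → ℕ) : Fin n → ℕ := fun i => v i.rev

/-- The action `w(b) = (b_{w(1)}, …, b_{w(n)})` of a permutation on sequences. -/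
def permute {n : ℕ} (w : Equiv.Perm (Fin n)) (b : Fin n → ℕ) : Fin n → ℕ := fun i => b (w i)

/-- The weakly decreasing rearrangement `v⁺` of a composition `v`. -/
def dominant {n : ℕ} (v : Fin n → ℕ) : Fin n → ℕ :=
  fun i => v (Tuple.sort v i.rev)

theorem dominant_antitone {n : ℕ} (v : Fin n → ℕ) : Antitone (dominant v) :=
  fun _ _ h => Tuple.monotone_sort v (Fin.rev_le_rev.mpr h)

/-- The sequence `lam` regarded as a sequence of length `N ≥ n` by appending zeros. -/
def pad {n : ℕ} (N : ℕ) (lam : Fin n → ℕ) : Fin N → ℕ :=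
  fun k => if h : (k : ℕ) < n then lam ⟨k, h⟩ else 0

/-! ### Schur polynomials -/

/-- The alternant `det (x_i ^ (lam_j + N - j))`, with `1 ≤ i, j ≤ N`. -/
def alternant {N : ℕ} (lam : Fin N → ℕ) : MvPolynomial (Fin N) ℤ :=
  (Matrix.of fun i j : Fin N => MvPolynomial.X i ^ (lam j + (N - 1 - (j : ℕ)))).det

/-- The product `∏_{i < j} (x_i - x_j)`. -/
def vandermondeProd (N : ℕ) : MvPolynomial (Fin N) ℤ :=
  ∏ p ∈ pairs N, (MvPolynomial.X p.1 - MvPolynomial.X p.2)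

/-- The substitution `x_j := x_i`. -/
def identify {N : ℕ} (i j : Fin N) : MvPolynomial (Fin N) ℤ →ₐ[ℤ] MvPolynomial (Fin N) ℤ :=
  MvPolynomial.aeval fun k => if k = j then MvPolynomial.X i else MvPolynomial.X k

theorem dvd_of_identify_eq_zero {N : ℕ} (i j : Fin N) (f : MvPolynomial (Fin N) ℤ)
    (hf : identify i j f = 0) : (MvPolynomial.X i - MvPolynomial.X j) ∣ f := by
  let I : Ideal (MvPolynomial (Fin N) ℤ) := Ideal.span {MvPolynomial.X i - MvPolynomial.X j}
  have h : (Ideal.Quotient.mkₐ ℤ I).comp (identify i j) = Ideal.Quotient.mkₐ ℤ I := by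
    apply MvPolynomial.algHom_ext
    intro k
    by_cases hk : k = j
    · subst hk
      simp only [identify, AlgHom.comp_apply, MvPolynomial.aeval_X, if_true,
        Ideal.Quotient.mkₐ_eq_mk]
      exact Ideal.Quotient.eq.mpr (Ideal.subset_span rfl)
    · simp [identify, hk]
  have h2 := DFunLike.congr_fun h f
  rw [AlgHom.comp_apply, hf, map_zero, Ideal.Quotient.mkₐ_eq_mk] at h2
  exact Ideal.mem_span_singleton.mp (Ideal.Quotient.eq_zero_iff_mem.mp h2.symm)

theorem irreducible_X_sub_X {N : ℕ} {i j : Fin N} (hij : i ≠ j) :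
    Irreducible (MvPolynomial.X i - MvPolynomial.X j : MvPolynomial (Fin N) ℤ) := by
  have hc : (MvPolynomial.X i - MvPolynomial.X j : MvPolynomial (Fin N) ℤ).coeff
      (Finsupp.single i 1) = 1 := by
    simp [MvPolynomial.coeff_X, hij.symm, Finsupp.single_left_inj]
  apply MvPolynomial.irreducible_of_totalDegree_eq_one
  · apply le_antisymm
    · exact (MvPolynomial.totalDegree_sub _ _).trans (by simp)
    · have := MvPolynomial.le_totalDegree (s := Finsupp.single i 1)
        (MvPolynomial.mem_support_iff.mpr (hc.trans_ne one_ne_zero))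
      simpa using this
  · intro x hx
    exact isUnit_of_dvd_one (hc ▸ hx (Finsupp.single i 1))

theorem vandermondeProd_dvd_alternant {N : ℕ} (lam : Fin N → ℕ) :
    vandermondeProd N ∣ alternant lam := by
  apply Finset.prod_dvd_of_isRelPrime
  · rintro ⟨i, j⟩ hij ⟨k, l⟩ hkl hne
    have hij' : i < j := by simpa [pairs] using hij
    have hkl' : k < l := by simpa [pairs] using hkl
    refine (irreducible_X_sub_X hij'.ne).isRelPrime_iff_not_dvd.mpr ?_
    rintro ⟨g, hg⟩
    have h := congrArg (identify i j) hg
    simp only [identify, map_mul, map_sub, MvPolynomial.aeval_X, if_true, hij'.ne, if_false,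
      sub_self, zero_mul, sub_eq_zero] at h
    apply hne
    split_ifs at h with h1 h2 h2 <;>
      simp only [MvPolynomial.X_injective.eq_iff] at h <;> grind
  · rintro ⟨i, j⟩ hij
    have hij' : i < j := by simpa [pairs] using hij
    apply dvd_of_identify_eq_zero
    rw [alternant, AlgHom.map_det]
    apply Matrix.det_zero_of_row_eq hij'.ne
    funext k
    simp [identify, hij'.ne]

/-- The Schur polynomial `s_lam(x_1, …, x_N)`, i.e. the quotient of `det (x_i ^ (lam_j + N - j))`
by `∏_{i < j} (x_i - x_j)`; see `schur_mul_vandermondeProd`. -/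
def schur {N : ℕ} (lam : Fin N → ℕ) : MvPolynomial (Fin N) ℤ :=
  (vandermondeProd_dvd_alternant lam).choose

theorem schur_mul_vandermondeProd {N : ℕ} (lam : Fin N → ℕ) :
    schur lam * vandermondeProd N = alternant lam := by
  rw [mul_comm]
  exact (vandermondeProd_dvd_alternant lam).choose_spec.symm

/-! ### `q`-shifted factorials, `q`-binomial coefficients and constant terms -/

/-- The coefficient field `ℚ(q)`. -/
abbrev K : Type := RatFunc ℚ

/-- The indeterminate `q`. -/
def q : K := RatFunc.X

/-- The `q`-shifted factorial `(z)_k = ∏_{i=0}^{k-1} (1 - z q^i)`. -/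
def qPoch {A : Type} [CommRing A] [Algebra K A] (z : A) (k : ℕ) : A :=
  ∏ i ∈ Finset.range k, (1 - z * algebraMap K A (q ^ i))

/-- The `q`-binomial coefficient. -/
def qbin (n m : ℕ) : K :=
  if m ≤ n then qPoch q n / (qPoch q m * qPoch q (n - m)) else 0

/-- Laurent polynomials in `x_1, …, x_n` over `ℚ(q)`. -/
abbrev Laurent (n : ℕ) : Type := AddMonoidAlgebra K (Fin n → ℤ)

/-- The Laurent monomial `x^u = x_1^{u_1} ⋯ x_n^{u_n}`. -/
def mono {n : ℕ} (u : Fin n → ℤ) : Laurent n := AddMonoidAlgebra.single u 1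

/-- The ratio `x_i / x_j`. -/
def ratio {n : ℕ} (i j : Fin n) : Laurent n := mono (Pi.single i 1 - Pi.single j 1)

/-- The constant term of a Laurent polynomial. -/
def CT {n : ℕ} (f : Laurent n) : K := f.coeff 0

/-- The alphabet `(x_1, x_1 q, …, x_1 q^{a_1-1}, …, x_n, x_n q, …, x_n q^{a_n-1})`
of length `a_1 + ⋯ + a_n`. -/
def alphabet {n : ℕ} (a : Fin n → ℕ) : Fin (∑ i, a i) → Laurent n := fun k =>
  mono (Pi.single (finSigmaFinEquiv.symm k).1 1) *
    algebraMap K (Laurent n) (q ^ ((finSigmaFinEquiv.symm k).2 : ℕ))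

/-- The `q`-Dyson product `∏_{i < j} (x_i/x_j)_{a_i} (q x_j/x_i)_{a_j}`. -/
def dysonProd {n : ℕ} (a : Fin n → ℕ) : Laurent n :=
  ∏ p ∈ pairs n, qPoch (ratio p.1 p.2) (a p.1) *
    qPoch (algebraMap K (Laurent n) q * ratio p.2 p.1) (a p.2)

/-- The constant term `D_{v,lam}(a)` of `x^{-v}` times the Schur polynomial `s_lam` in the above
alphabet times the `q`-Dyson product; `lam` has length `|a| = a_1 + ⋯ + a_n`. -/
def D₂ {n : ℕ} (v : Fin n → ℕ) (a : Fin n → ℕ) (lam : Fin (∑ i, a i) → ℕ) : K :=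
  CT (mono (fun i => -(v i : ℤ)) * MvPolynomial.aeval (alphabet a) (schur lam) * dysonProd a)

/-- `D_v(a) = D_{v,v⁺}(a)`, for positive `a_i` (so that `n ≤ |a|`). -/
def D {n : ℕ} (v : Fin n → ℕ) (a : Fin n → ℕ) : K :=
  D₂ v a (pad (∑ i, a i) (dominant v))

end

end QDyson

namespace QDyson

/-! The constant term obeys a recursion that removes the variable carrying the largest exponent.

Put `N = |a|`. Expanding the alternant along its first column gives `s_μ(y) = ∑_l y_l^{μ_1} s_{μ'}(y
without y_l) · y_l^{N-1} / ∏_{m≠l} (y_l - y_m)`, where `μ'` is `μ` without its largest part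
(`mul_schurEval_eq_sum`). Multiply by the `q`-Dyson product and let `y_l = x_i q^k`. As polynomials
in `x_i/x_j`, the denominators coming from the letters of `x_j` have simple zeros, all of which are
zeros of the Dyson factors joining `x_i` and `x_j` (`exists_dyson_factor`). So the product times
`y_l^{N-1} / ∏ (y_l - y_m)` is a polynomial in `x_i`, with an explicit value at `x_i = 0`
(`exists_quotient`).

The whole term is thus `x_i^{μ_1}` times a polynomial in `x_i`. Against `x^{-v}` it contributes
nothing if `v_i < μ_1`, and its value at `x_i = 0` if `v_i = μ_1` (`CT_mono_mul_polyEmbed`). When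
the maximum of `v` occurs only once, a single `i` survives, and setting `x_i = 0` leaves the same
problem in the other variables. The remaining sum over `k` is a divided difference of a power
function at `1, q, …, q^{a_i-1}`, hence a `q`-binomial coefficient (`sum_pow_div_prod_sub`). This is
`D₂_eq_of_unique_max`; strictness of `λ` allows it to be iterated (`D₂_permute_bar`). -/

theorem prod_pairs_eq {M : Type*} [CommMonoid M] (n : ℕ) (g : Fin n → Fin n → M) :
    ∏ p ∈ pairs n, g p.1 p.2 = ∏ i, ∏ j, if i < j then g i j else 1 := by
  rw [pairs, Finset.prod_filter, ← Finset.univ_product_univ, Finset.prod_product]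

/-- A product over pairs, with the pairs that contain a given index `i` split off. -/
theorem prod_pairs_succAbove {M : Type*} [CommMonoid M] {n : ℕ} (i : Fin (n + 1))
    (g : Fin (n + 1) → Fin (n + 1) → M) :
    ∏ p ∈ pairs (n + 1), g p.1 p.2 =
      (∏ j, if i < i.succAbove j then g i (i.succAbove j) else g (i.succAbove j) i) *
        ∏ p ∈ pairs n, g (i.succAbove p.1) (i.succAbove p.2) := by
  rw [prod_pairs_eq, prod_pairs_eq n fun k l => g (i.succAbove k) (i.succAbove l),
    Fin.prod_univ_succAbove _ i]
  simp_rw [Fin.prod_univ_succAbove (fun j => if _ < j then _ else _) i]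
  rw [Finset.prod_mul_distrib]
  simp only [lt_self_iff_false, if_false, one_mul, Fin.succAbove_lt_succAbove_iff]
  rw [← mul_assoc, ← Finset.prod_mul_distrib]
  congr 1
  refine Finset.prod_congr rfl fun j _ => ?_
  rcases lt_or_gt_of_ne (i.succAbove_ne j) with h | h
  · simp [h, h.not_gt]
  · simp [h, h.not_gt]

/-! ### Schur polynomials -/

theorem map_aeval_int {A B F : Type*} [CommRing A] [CommRing B] [Algebra ℤ A] [Algebra ℤ B]
    [FunLike F A B] [RingHomClass F A B] {N : ℕ} (f : F) (y : Fin N → A)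
    (p : MvPolynomial (Fin N) ℤ) :
    f (MvPolynomial.aeval y p) = MvPolynomial.aeval (fun i => f (y i)) p := by
  induction p using MvPolynomial.induction_on with
  | C r => simp
  | add p r hp hr => simp [hp, hr]
  | mul_X p i hp => simp [hp]

theorem aeval_vandermondeProd {A : Type*} [CommRing A] [Algebra ℤ A] {N : ℕ} (y : Fin N → A) :
    MvPolynomial.aeval y (vandermondeProd N) = ∏ p ∈ pairs N, (y p.1 - y p.2) := by
  simp [vandermondeProd, map_prod]

theorem aeval_alternant {A : Type*} [CommRing A] [Algebra ℤ A] {N : ℕ} (y : Fin N → A)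
    (lam : Fin N → ℕ) :
    MvPolynomial.aeval y (alternant lam) =
      (Matrix.of fun i j : Fin N => y i ^ (lam j + (N - 1 - (j : ℕ)))).det := by
  rw [alternant, AlgHom.map_det]
  congr 1
  ext i j
  simp

theorem aeval_schur_mul {A : Type*} [CommRing A] [Algebra ℤ A] {N : ℕ} (y : Fin N → A)
    (lam : Fin N → ℕ) :
    MvPolynomial.aeval y (schur lam) * ∏ p ∈ pairs N, (y p.1 - y p.2) =
      (Matrix.of fun i j : Fin N => y i ^ (lam j + (N - 1 - (j : ℕ)))).det := by
  rw [← aeval_vandermondeProd, ← map_mul, schur_mul_vandermondeProd, aeval_alternant]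

theorem prod_pairs_sub_eq_det {A : Type*} [CommRing A] {N : ℕ} (y : Fin N → A) :
    ∏ p ∈ pairs N, (y p.1 - y p.2) =
      (Matrix.of fun i j : Fin N => y i ^ (N - 1 - (j : ℕ))).det := by
  have h := Matrix.det_projVandermonde (fun _ => 1) y
  have h2 : Matrix.projVandermonde (fun _ => 1) y =
      Matrix.of fun i j : Fin N => y i ^ (N - 1 - (j : ℕ)) := by
    ext i j
    rw [Matrix.projVandermonde_apply, one_pow, one_mul, Matrix.of_apply, Fin.val_rev]
    congr 1
    omega
  rw [← h2, h, prod_pairs_eq N fun i j => y i - y j]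
  refine Finset.prod_congr rfl fun i _ => ?_
  rw [← Finset.prod_filter]
  refine Finset.prod_congr ?_ fun j _ => by ring
  ext; simp

theorem prod_pairs_sub_ne_zero {A : Type*} [CommRing A] [IsDomain A] {N : ℕ} {y : Fin N → A}
    (hy : Function.Injective y) : ∏ p ∈ pairs N, (y p.1 - y p.2) ≠ 0 := by
  refine Finset.prod_ne_zero_iff.mpr fun p hp => sub_ne_zero.mpr (hy.ne ?_)
  exact (Finset.mem_filter.mp hp).2.ne

/-- The alternant and the Vandermonde product both change by the sign of `σ`. Injectivity of `y` in
a domain makes the Vandermonde product cancellable. -/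
theorem aeval_schur_comp_perm_of_injective {A : Type*} [CommRing A] [IsDomain A] {N : ℕ}
    [Algebra ℤ A] {y : Fin N → A} (hy : Function.Injective y) (lam : Fin N → ℕ)
    (σ : Equiv.Perm (Fin N)) :
    MvPolynomial.aeval (y ∘ σ) (schur lam) = MvPolynomial.aeval y (schur lam) := by
  have h1 := aeval_schur_mul (y ∘ σ) lam
  have h2 := aeval_schur_mul y lam
  have h3 := prod_pairs_sub_eq_det (y ∘ σ)
  have h4 := prod_pairs_sub_eq_det y
  have h5 := prod_pairs_sub_ne_zero (hy.comp σ.injective)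
  have e1 := Matrix.det_permute σ (Matrix.of fun i j : Fin N => y i ^ (lam j + (N - 1 - (j : ℕ))))
  have e2 := Matrix.det_permute σ (Matrix.of fun i j : Fin N => y i ^ (N - 1 - (j : ℕ)))
  apply mul_right_cancel₀ h5
  refine h1.trans (e1.trans ?_)
  rw [← h2, h3]
  refine Eq.trans ?_ (congrArg _ e2.symm)
  rw [← h4]
  ring

/-- The generic variables are distinct elements of a domain, so the injective case applies to them;
specialization gives any `y`. -/
theorem aeval_schur_comp_perm {A : Type*} [CommRing A] {N : ℕ} (y : Fin N → A)
    (lam : Fin N → ℕ) (σ : Equiv.Perm (Fin N)) :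
    MvPolynomial.aeval (y ∘ σ) (schur lam) = MvPolynomial.aeval y (schur lam) := by
  have h := congrArg (MvPolynomial.aeval y) (aeval_schur_comp_perm_of_injective
    (MvPolynomial.X_injective (σ := Fin N) (R := ℤ)) lam σ)
  rw [MvPolynomial.aeval_X_left_apply, map_aeval_int] at h
  rw [← h]
  congr 2
  ext i
  simp

theorem pad_succ {n : ℕ} (N : ℕ) (lam : Fin (n + 1) → ℕ) (j : Fin N) :
    pad (N + 1) lam j.succ = pad N (lam ∘ Fin.succ) j := by
  simp only [pad, Fin.val_succ, Nat.add_lt_add_iff_right]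
  rfl

/-- Setting the last variable of a Schur polynomial to zero. -/
theorem aeval_snoc_zero_schur {A : Type*} [CommRing A] {n N : ℕ} (hn : n ≤ N) (lam : Fin n → ℕ)
    (y : Fin N → A) :
    MvPolynomial.aeval (Fin.snoc y 0 : Fin (N + 1) → A) (schur (pad (N + 1) lam)) =
      MvPolynomial.aeval y (schur (pad N lam)) := by
  -- It suffices to treat generic variables, where the Vandermonde product can be cancelled.
  have key : MvPolynomial.aeval
      (Fin.snoc (MvPolynomial.X (σ := Fin N) (R := ℤ)) 0 : Fin (N + 1) → _)
      (schur (pad (N + 1) lam)) = schur (pad N lam) := by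
    set x : Fin N → MvPolynomial (Fin N) ℤ := MvPolynomial.X with hx
    have hV := prod_pairs_sub_ne_zero (MvPolynomial.X_injective (σ := Fin N) (R := ℤ))
    rw [← hx] at hV
    have hX : (∏ i, x i) ≠ 0 := Finset.prod_ne_zero_iff.mpr fun i _ => MvPolynomial.X_ne_zero i
    have h1 := aeval_schur_mul (Fin.snoc x 0 : Fin (N + 1) → _) (pad (N + 1) lam)
    have h2 := aeval_schur_mul x (pad N lam)
    have h3 := prod_pairs_succAbove (Fin.last N)
      fun i j => (Fin.snoc x 0 : Fin (N + 1) → MvPolynomial (Fin N) ℤ) i -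
        (Fin.snoc x 0 : Fin (N + 1) → _) j
    have hlt : ∀ j : Fin N, ¬ Fin.last N < Fin.castSucc j := fun j =>
      (Fin.castSucc_lt_last j).not_gt
    simp only [Fin.succAbove_last, hlt, if_false, Fin.snoc_castSucc, Fin.snoc_last, sub_zero] at h3
    rw [hx, MvPolynomial.aeval_X_left_apply, ← hx] at h2
    -- In the row of the variable 0 the exponents are positive except in the last column, where the
    -- exponent is 0 because `n ≤ N` makes the last padded part vanish.
    rw [h3, Matrix.det_succ_row _ (Fin.last N), Finset.sum_eq_single (Fin.last N)] at h1
    · apply mul_right_cancel₀ (mul_ne_zero hX hV)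
      rw [h1, mul_left_comm, h2]
      simp only [Matrix.of_apply, Fin.snoc_last, Fin.val_last, Fin.succAbove_last]
      have hp : pad (N + 1) lam (Fin.last N) = 0 := by simp [pad, hn]
      -- The factor `∏ x_i` from the Vandermonde product raises every exponent of the smaller
      -- alternant by one.
      rw [hp, ← Matrix.det_mul_column]
      simp only [add_tsub_cancel_right, tsub_self, add_zero, pow_zero, mul_one,
        Even.neg_one_pow ⟨N, rfl⟩, one_mul]
      congr 1
      ext1 i j
      simp only [Matrix.submatrix_apply, Matrix.of_apply, Fin.snoc_castSucc, Fin.val_castSucc]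
      rw [← pow_succ']
      have : pad (N + 1) lam j.castSucc = pad N lam j := by simp [pad]
      rw [this]
      congr 1
      have := j.isLt
      omega
    · intro j _ hj
      have : (j : ℕ) < N := Fin.val_lt_last hj
      simp only [Matrix.of_apply, Fin.snoc_last]
      rw [zero_pow (by omega)]
      simp
    · simp
  have h := congrArg (MvPolynomial.aeval y) key
  rw [map_aeval_int] at h
  rw [← h]
  congr 2
  ext i
  refine Fin.lastCases ?_ (fun i => ?_) i <;> simp

/-- The Schur polynomial indexed by `lam`, evaluated at a finite family. -/
noncomputable def schurEval {A ι : Type*} [CommRing A] [Fintype ι] {n : ℕ} (lam : Fin n → ℕ)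
    (z : ι → A) : A :=
  MvPolynomial.aeval (z ∘ (Fintype.equivFin ι).symm) (schur (pad (Fintype.card ι) lam))

theorem schurEval_eq_aeval {A ι : Type*} [CommRing A] [Fintype ι] {n N : ℕ} (lam : Fin n → ℕ)
    (z : ι → A) (e : Fin N ≃ ι) :
    schurEval lam z = MvPolynomial.aeval (z ∘ e) (schur (pad N lam)) := by
  obtain rfl : N = Fintype.card ι := by simpa using Fintype.card_congr e
  rw [schurEval, ← aeval_schur_comp_perm _ _ (e.trans (Fintype.equivFin ι))]
  congr 2
  ext i
  simp

theorem schurEval_of_isEmpty {A ι : Type*} [CommRing A] [Fintype ι] [IsEmpty ι] {n : ℕ}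
    (lam : Fin n → ℕ) (z : ι → A) : schurEval lam z = 1 := by
  rw [schurEval_eq_aeval lam z (Equiv.equivOfIsEmpty (Fin 0) ι)]
  have h := aeval_schur_mul (z ∘ Equiv.equivOfIsEmpty (Fin 0) ι) (pad 0 lam)
  simpa [pairs] using h

theorem map_schurEval {A B F ι : Type*} [CommRing A] [CommRing B] [FunLike F A B]
    [RingHomClass F A B] [Fintype ι] {n : ℕ} (f : F)
    (lam : Fin n → ℕ) (z : ι → A) : f (schurEval lam z) = schurEval lam fun i => f (z i) :=
  map_aeval_int f _ _

/-- Zeros may be removed from the arguments of a Schur polynomial. -/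
theorem schurEval_of_eq_zero {A ι κ : Type*} [CommRing A] [Fintype ι] [Fintype κ] {n : ℕ}
    (lam : Fin n → ℕ) (z : ι → A) (f : κ ↪ ι) (hf : ∀ i, i ∉ Set.range f → z i = 0)
    (hn : n ≤ Fintype.card κ) : schurEval lam z = schurEval lam (z ∘ f) := by
  classical
  have key : ∀ (d m : ℕ), n ≤ m → ∀ y : Fin m → A,
      MvPolynomial.aeval (Fin.append y (0 : Fin d → A)) (schur (pad (m + d) lam)) =
        MvPolynomial.aeval y (schur (pad m lam)) := by
    intro d m hm y
    induction d with
    | zero => rw [Fin.append_right_nil _ _ rfl]; rfl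
    | succ d ih =>
      rw [← ih, ← aeval_snoc_zero_schur (hm.trans (Nat.le_add_right m d))]
      congr 2
      rw [← Fin.append_snoc]
      congr 1
      ext i
      refine Fin.lastCases ?_ (fun i => ?_) i <;> simp
  let e : κ ⊕ {i // i ∉ Set.range f} ≃ ι :=
    ((Equiv.ofInjective f f.injective).sumCongr (Equiv.refl _)).trans
      (Equiv.sumCompl (· ∈ Set.range f))
  let e' := (finSumFinEquiv.symm.trans (((Fintype.equivFin κ).symm.sumCongr
    (Fintype.equivFin {i // i ∉ Set.range f}).symm))).trans e
  rw [schurEval_eq_aeval lam z e', schurEval, ← key (Fintype.card {i // i ∉ Set.range f}) _ hn]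
  congr 2
  ext i
  refine Fin.addCases (fun i => ?_) (fun i => ?_) i
  · simp [e', e]
  · simp only [Fin.append_right]
    apply hf
    simp only [e', e, Equiv.trans_apply, finSumFinEquiv_symm_apply_natAdd, Equiv.sumCongr_apply,
      Sum.map_inr, Equiv.refl_apply, Equiv.sumCompl_apply_inr]
    exact ((Fintype.equivFin {i // i ∉ Set.range f}).symm i).2

/-- The sign counts the indices below `l`; it is the cofactor sign of row `l` in the expansion along
the first column. -/
theorem prod_pairs_sub_succAbove {A : Type*} [CommRing A] {N : ℕ} (y : Fin (N + 1) → A)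
    (l : Fin (N + 1)) :
    ∏ p ∈ pairs (N + 1), (y p.1 - y p.2) = (-1) ^ (l : ℕ) *
      (∏ m, (y l - y (l.succAbove m))) *
        ∏ p ∈ pairs N, (y (l.succAbove p.1) - y (l.succAbove p.2)) := by
  rw [prod_pairs_succAbove l fun i j => y i - y j]
  congr 1
  have h : (-1 : A) ^ (l : ℕ) = ∏ m : Fin N, if l.succAbove m < l then -1 else 1 := by
    rw [← Finset.prod_filter, Finset.prod_const]
    congr 1
    have : Finset.univ.filter (fun m : Fin N => l.succAbove m < l) =
      Finset.univ.filter fun m : Fin N => (m : ℕ) < l := by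
      ext m
      rw [Finset.mem_filter_univ, Finset.mem_filter_univ, Fin.succAbove_lt_iff_castSucc_lt,
        Fin.lt_def, Fin.val_castSucc]
    rw [this, Fin.card_filter_val_lt]
    have := l.isLt
    omega
  rw [h, ← Finset.prod_mul_distrib]
  refine Finset.prod_congr rfl fun m _ => ?_
  rcases lt_or_gt_of_ne (l.succAbove_ne m) with h | h
  · simp [h, h.not_gt]
  · simp [h, h.not_gt]

/-- The expansion of a Schur polynomial with respect to the largest part, multiplied by an
element `P` that clears the denominators. -/
theorem mul_aeval_schur_eq_sum {A : Type*} [CommRing A] [IsDomain A] {n N : ℕ}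
    (lam : Fin (n + 1) → ℕ) {y : Fin (N + 1) → A} (hy : Function.Injective y) (P : A)
    (B : Fin (N + 1) → A) (hB : ∀ l, B l * ∏ m, (y l - y (l.succAbove m)) = P * y l ^ N) :
    P * MvPolynomial.aeval y (schur (pad (N + 1) lam)) =
      ∑ l, y l ^ lam 0 * MvPolynomial.aeval (y ∘ l.succAbove) (schur (pad N (lam ∘ Fin.succ))) *
        B l := by
  apply mul_right_cancel₀ (prod_pairs_sub_ne_zero hy)
  rw [mul_assoc, aeval_schur_mul, Matrix.det_succ_column_zero, Finset.mul_sum, Finset.sum_mul]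
  refine Finset.sum_congr rfl fun l _ => ?_
  have h := aeval_schur_mul (y ∘ l.succAbove) (pad N (lam ∘ Fin.succ))
  have h2 : ((Matrix.of fun i j : Fin (N + 1) =>
      y i ^ (pad (N + 1) lam j + (N + 1 - 1 - (j : ℕ)))).submatrix l.succAbove Fin.succ) =
      Matrix.of fun i j : Fin N =>
        (y ∘ l.succAbove) i ^ (pad N (lam ∘ Fin.succ) j + (N - 1 - (j : ℕ))) := by
    ext i j
    simp only [Matrix.submatrix_apply, Matrix.of_apply, pad_succ, Function.comp_apply, Fin.val_succ]
    congr 2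
    omega
  rw [h2, ← h, prod_pairs_sub_succAbove y l]
  have h0 : pad (N + 1) lam 0 = lam 0 := by simp [pad]
  simp only [Matrix.of_apply, h0, Fin.val_zero, add_tsub_cancel_right, tsub_zero, pow_add,
    Function.comp_apply]
  linear_combination (-(-1) ^ (l : ℕ) * y l ^ lam 0 *
    MvPolynomial.aeval (y ∘ l.succAbove) (schur (pad N (lam ∘ Fin.succ))) *
    ∏ p ∈ pairs N, (y (l.succAbove p.1) - y (l.succAbove p.2))) * hB l

theorem mul_schurEval_eq_sum {A ι : Type*} [CommRing A] [IsDomain A] [Fintype ι] [DecidableEq ι]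
    {n : ℕ} (lam : Fin (n + 1) → ℕ) {z : ι → A} (hz : Function.Injective z) (P : A) (B : ι → A)
    (hB : ∀ l, B l * ∏ m : {m // m ≠ l}, (z l - z m) = P * z l ^ (Fintype.card ι - 1))
    [Nonempty ι] :
    P * schurEval lam z =
      ∑ l, z l ^ lam 0 * schurEval (lam ∘ Fin.succ) (fun m : {m // m ≠ l} => z m) * B l := by
  obtain ⟨N, hN⟩ : ∃ N, Fintype.card ι = N + 1 :=
    Nat.exists_eq_succ_of_ne_zero Fintype.card_ne_zero
  let e : Fin (N + 1) ≃ ι := (finCongr hN.symm).trans (Fintype.equivFin ι).symm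
  let s (l : Fin (N + 1)) : Fin N ≃ {m // m ≠ e l} :=
    (finSuccAboveEquiv l).trans (e.subtypeEquiv fun a => by simp)
  have hs : ∀ l m, ((s l m : {m // m ≠ e l}) : ι) = e (l.succAbove m) := fun l m => rfl
  rw [schurEval_eq_aeval lam z e, mul_aeval_schur_eq_sum lam (hz.comp e.injective) P (B ∘ e),
    ← e.sum_comp]
  · refine Finset.sum_congr rfl fun l _ => ?_
    rw [schurEval_eq_aeval (lam ∘ Fin.succ) _ (s l)]
    rfl
  · intro l
    have h := hB (e l)
    rw [← (s l).prod_comp, hN] at h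
    exact h

/-! ### Identities in `ℚ(q)` and divisibility of polynomials over it -/

theorem q_ne_zero : q ≠ 0 := RatFunc.X_ne_zero

theorem q_pow_injective : Function.Injective fun m : ℕ => q ^ m := by
  intro m k h
  have h' : algebraMap (Polynomial ℚ) K (Polynomial.X ^ m) =
      algebraMap (Polynomial ℚ) K (Polynomial.X ^ k) := by
    simpa [q, RatFunc.algebraMap_X] using h
  have := congrArg Polynomial.natDegree (RatFunc.algebraMap_injective ℚ h')
  simpa using this

theorem one_sub_q_pow_ne_zero {m : ℕ} (hm : 0 < m) : 1 - q ^ m ≠ 0 := by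
  intro h
  exact hm.ne (q_pow_injective ((pow_zero q).trans (sub_eq_zero.mp h)))

theorem qPoch_q_succ (n : ℕ) : qPoch q (n + 1) = qPoch q n * (1 - q ^ (n + 1)) := by
  simp [qPoch, Finset.prod_range_succ, pow_succ']

theorem qPoch_q_ne_zero (n : ℕ) : qPoch q n ≠ 0 := by
  induction n with
  | zero => simp [qPoch]
  | succ n ih =>
    rw [qPoch_q_succ]
    exact mul_ne_zero ih (one_sub_q_pow_ne_zero n.succ_pos)

theorem qbin_zero_right (n : ℕ) : qbin n 0 = 1 := by
  have h := qPoch_q_ne_zero n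
  rw [qbin, if_pos n.zero_le]
  simp only [qPoch, Finset.range_zero, Finset.prod_empty, one_mul, tsub_zero] at h ⊢
  exact div_self h

theorem one_sub_mul_qbin_succ {r m : ℕ} (h : m + 1 ≤ r) :
    (1 - q ^ (m + 1)) * qbin r (m + 1) = (1 - q ^ (r - m)) * qbin r m := by
  obtain ⟨d, rfl⟩ := Nat.exists_eq_add_of_le h
  have h1 := qPoch_q_ne_zero m
  have h2 := qPoch_q_ne_zero d
  have h3 := one_sub_q_pow_ne_zero m.succ_pos
  have h4 := one_sub_q_pow_ne_zero d.succ_pos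
  rw [qbin, qbin, if_pos h, if_pos (by omega), show m + 1 + d - (m + 1) = d by omega,
    show m + 1 + d - m = d + 1 by omega, qPoch_q_succ m, qPoch_q_succ d]
  field_simp

/-- The `q`-binomial coefficient as a complete homogeneous symmetric polynomial in
`1, q, …, q ^ m`, written as a divided difference. -/
theorem sum_pow_div_prod_sub (m r : ℕ) (h : m ≤ r) :
    ∑ k ∈ Finset.range (m + 1),
      (q ^ k) ^ r / ∏ l ∈ Finset.range (m + 1), (if l = k then 1 else q ^ k - q ^ l) =
        qbin r m := by
  induction m with
  | zero => simp [qbin_zero_right]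
  | succ m ih =>
    set S := ∑ k ∈ Finset.range (m + 1),
      (q ^ k) ^ r / ∏ l ∈ Finset.range (m + 1), (if l = k then 1 else q ^ k - q ^ l) with hS
    set T : ℕ → K := fun k =>
      (q ^ k) ^ r / ∏ l ∈ Finset.range (m + 2), (if l = k then 1 else q ^ k - q ^ l) with hT
    -- The factor `q^k - q^(m+1)` removes the last node, and `q^k - 1` in `hfirst` removes the first
    -- one, leaving the nodes of `S` scaled by `q`. Subtracting the two yields the recurrence of the
    -- `q`-binomial coefficient.
    have hlast : ∑ k ∈ Finset.range (m + 2), (q ^ k - q ^ (m + 1)) * T k = S := by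
      rw [Finset.sum_range_succ, sub_self, zero_mul, add_zero]
      refine Finset.sum_congr rfl fun k hk => ?_
      have hk' : k ≠ m + 1 := (Finset.mem_range.mp hk).ne
      have hne : q ^ k - q ^ (m + 1) ≠ 0 := sub_ne_zero.mpr (q_pow_injective.ne hk')
      simp only [hT]
      rw [Finset.prod_range_succ _ (m + 1), if_neg hk'.symm, mul_comm (∏ _ ∈ _, _), ← div_div,
        ← mul_div_assoc, mul_div_cancel₀ _ hne]
    have hfirst : ∑ k ∈ Finset.range (m + 2), (q ^ k - 1) * T k = q ^ (r - m) * S := by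
      rw [Finset.sum_range_succ', pow_zero, sub_self, zero_mul, add_zero, hS, Finset.mul_sum]
      refine Finset.sum_congr rfl fun k hk => ?_
      have hne : q ^ (k + 1) - 1 ≠ 0 := by
        rw [← neg_sub]
        exact neg_ne_zero.mpr (one_sub_q_pow_ne_zero k.succ_pos)
      have hprod : ∏ l ∈ Finset.range (m + 1),
          (if l + 1 = k + 1 then 1 else q ^ (k + 1) - q ^ (l + 1)) =
          q ^ m * ∏ l ∈ Finset.range (m + 1), (if l = k then 1 else q ^ k - q ^ l) := by
        rw [← Finset.mul_prod_erase _ _ hk,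
          ← Finset.mul_prod_erase _ (fun l => if l = k then _ else _) hk,
          if_pos rfl, if_pos rfl, one_mul, one_mul]
        have hc : q ^ m = ∏ _l ∈ (Finset.range (m + 1)).erase k, q := by
          rw [Finset.prod_const, Finset.card_erase_of_mem hk, Finset.card_range,
            Nat.add_sub_cancel]
        rw [hc, ← Finset.prod_mul_distrib]
        refine Finset.prod_congr rfl fun l hl => ?_
        have := Finset.ne_of_mem_erase hl
        rw [if_neg (by omega), if_neg this]
        ring
      simp only [hT]
      rw [Finset.prod_range_succ' _ (m + 1), if_neg (by omega), pow_zero, hprod,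
        mul_comm _ (q ^ (k + 1) - 1), ← div_div, ← mul_div_assoc, mul_div_cancel₀ _ hne,
        ← div_div, ← mul_div_assoc]
      congr 1
      rw [div_eq_iff (pow_ne_zero _ q_ne_zero), mul_right_comm, ← pow_add,
        Nat.sub_add_cancel (by omega)]
      ring
    have hdiff : (1 - q ^ (m + 1)) * ∑ k ∈ Finset.range (m + 2), T k = (1 - q ^ (r - m)) * S := by
      rw [sub_mul, sub_mul, one_mul, one_mul, ← hfirst, ← hlast, Finset.mul_sum,
        ← Finset.sum_sub_distrib, ← Finset.sum_sub_distrib]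
      exact Finset.sum_congr rfl fun k _ => by ring
    apply mul_left_cancel₀ (one_sub_q_pow_ne_zero m.succ_pos)
    rw [one_sub_mul_qbin_succ h, ← ih (by omega)]
    exact hdiff

open Polynomial in
/-- The factor of the `q`-Dyson product that belongs to a pair of variables, divided by a factor
of the Vandermonde product, is a polynomial in the ratio of the two variables. -/
theorem exists_dyson_factor (a b k ε : ℕ) (hk : k < a) (hε : ε ≤ 1) :
    ∃ f : K[X], f * ∏ l ∈ Finset.range b, (C (q ^ k) * X - C (q ^ l)) =
      C (q ^ (k * b)) * (∏ m ∈ Finset.range a, (1 - C (q ^ (1 - ε + m)) * X)) *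
        ∏ l ∈ Finset.range b, (X - C (q ^ (ε + l))) ∧ f.coeff 0 = q ^ ((k + ε) * b) := by
  have hqk : q ^ k ≠ 0 := pow_ne_zero _ q_ne_zero
  have hdvd : ∏ l ∈ Finset.range b, (C (q ^ k) * X - C (q ^ l)) ∣
      C (q ^ (k * b)) * (∏ m ∈ Finset.range a, (1 - C (q ^ (1 - ε + m)) * X)) *
        ∏ l ∈ Finset.range b, (X - C (q ^ (ε + l))) := by
    -- The divisor is `q^(k*b)` times a product of distinct monic linear factors with roots
    -- `q^(l-k)`, so divisibility can be checked root by root.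
    have hfac : ∀ l, C (q ^ k) * X - C (q ^ l) = C (q ^ k) * (X - C (q ^ l / q ^ k)) := by
      intro l
      rw [mul_sub, ← C_mul, mul_div_cancel₀ _ hqk]
    simp_rw [hfac]
    rw [Finset.prod_mul_distrib, Finset.prod_const, Finset.card_range, ← C_pow, ← pow_mul,
      mul_assoc]
    refine mul_dvd_mul_left _ (Finset.prod_dvd_of_coprime ?_ fun l hl => ?_)
    · refine Pairwise.set_pairwise (pairwise_coprime_X_sub_C (s := fun l => q ^ l / q ^ k) ?_) _
      intro l m h
      exact q_pow_injective ((div_left_inj' hqk).mp h)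
    · have hl' := Finset.mem_range.mp hl
      rw [dvd_iff_isRoot, IsRoot, eval_mul, eval_prod, eval_prod, mul_eq_zero]
      -- For `l < k + ε` the root belongs to the first product, with `m = k + ε - 1 - l ≤ k < a`;
      -- otherwise it is the root `q^(ε + (l - k - ε))` of the second.
      rcases lt_or_ge l (k + ε) with h | h
      · left
        refine Finset.prod_eq_zero (i := k + ε - 1 - l) (Finset.mem_range.mpr (by omega)) ?_
        simp only [eval_sub, eval_one, eval_mul, eval_C, eval_X]
        rw [mul_div_assoc', ← pow_add, show 1 - ε + (k + ε - 1 - l) + l = k by omega,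
          div_self hqk, sub_self]
      · right
        refine Finset.prod_eq_zero (i := l - (k + ε)) (Finset.mem_range.mpr (by omega)) ?_
        simp only [eval_sub, eval_C, eval_X]
        rw [sub_eq_zero, div_eq_iff hqk, ← pow_add]
        congr 1
        omega
  obtain ⟨f, hf⟩ := hdvd
  refine ⟨f, by rw [hf, mul_comm], ?_⟩
  have h0 := congrArg (eval 0) hf
  simp only [eval_mul, eval_prod, eval_sub, eval_C, eval_X, eval_one, mul_zero, sub_zero, zero_sub,
    Finset.prod_const_one, mul_one, pow_add] at h0
  rw [coeff_zero_eq_eval_zero]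
  have hne : ∏ l ∈ Finset.range b, -(q ^ l) ≠ 0 :=
    Finset.prod_ne_zero_iff.mpr fun l _ => neg_ne_zero.mpr (pow_ne_zero _ q_ne_zero)
  apply mul_left_cancel₀ hne
  rw [← h0]
  have : ∏ l ∈ Finset.range b, -(q ^ ε * q ^ l) = q ^ (ε * b) * ∏ l ∈ Finset.range b, -(q ^ l) := by
    rw [pow_mul, ← Finset.card_range b, ← Finset.prod_const, Finset.card_range,
      ← Finset.prod_mul_distrib]
    exact Finset.prod_congr rfl fun l _ => by ring
  rw [this]
  ring

/-! ### Laurent polynomials that are polynomial in one of the variables -/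

theorem mono_add {n : ℕ} (u v : Fin n → ℤ) : mono (u + v) = mono u * mono v := by
  simp [mono, AddMonoidAlgebra.single_mul_single]

theorem mono_zero {n : ℕ} : mono (0 : Fin n → ℤ) = 1 := rfl

theorem mono_pow {n : ℕ} (u : Fin n → ℤ) (r : ℕ) : mono u ^ r = mono (r • u) := by
  simp [mono, AddMonoidAlgebra.single_pow]

theorem algebraMap_mul_mono {n : ℕ} (c : K) (u : Fin n → ℤ) :
    algebraMap K (Laurent n) c * mono u = AddMonoidAlgebra.single u c := by
  simp [mono, AddMonoidAlgebra.coe_algebraMap, AddMonoidAlgebra.single_mul_single]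

/-- Insertion of a zero exponent at position `i`. -/
def insertZero {n : ℕ} (i : Fin (n + 1)) : (Fin n → ℤ) →+ (Fin (n + 1) → ℤ) :=
  AddMonoidHom.mk' (fun u => i.insertNth 0 u) fun u v => by
    ext j
    refine Fin.succAboveCases i ?_ (fun j => ?_) j <;> simp

@[simp] theorem insertZero_apply_same {n : ℕ} (i : Fin (n + 1)) (u : Fin n → ℤ) :
    insertZero i u i = 0 := by simp [insertZero]

@[simp] theorem insertZero_apply_succAbove {n : ℕ} (i : Fin (n + 1)) (u : Fin n → ℤ) (j : Fin n) :
    insertZero i u (i.succAbove j) = u j := by simp [insertZero]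

theorem insertZero_single {n : ℕ} (i : Fin (n + 1)) (j : Fin n) (c : ℤ) :
    insertZero i (Pi.single j c) = Pi.single (i.succAbove j) c := by
  ext k
  refine Fin.succAboveCases i ?_ (fun k => ?_) k
  · simp [(i.succAbove_ne j).symm]
  · simp [Pi.single_apply]

/-- Laurent polynomials that do not involve `x_i`. -/
noncomputable def embed {n : ℕ} (i : Fin (n + 1)) : Laurent n →ₐ[K] Laurent (n + 1) :=
  AddMonoidAlgebra.mapDomainAlgHom K K (insertZero i)

theorem embed_single {n : ℕ} (i : Fin (n + 1)) (u : Fin n → ℤ) (c : K) :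
    embed i (AddMonoidAlgebra.single u c) = AddMonoidAlgebra.single (insertZero i u) c := by
  simp [embed]

theorem embed_mono {n : ℕ} (i : Fin (n + 1)) (u : Fin n → ℤ) :
    embed i (mono u) = mono (insertZero i u) := embed_single i u 1

theorem embed_ratio {n : ℕ} (i : Fin (n + 1)) (j k : Fin n) :
    embed i (ratio j k) = ratio (i.succAbove j) (i.succAbove k) := by
  rw [ratio, embed_mono, map_sub, insertZero_single, insertZero_single, ratio]

theorem map_qPoch {A B : Type} [CommRing A] [CommRing B] [Algebra K A] [Algebra K B]
    (f : A →ₐ[K] B) (z : A) (k : ℕ) : f (qPoch z k) = qPoch (f z) k := by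
  simp [qPoch, map_prod]

theorem embed_dysonProd {n : ℕ} (i : Fin (n + 1)) (a : Fin n → ℕ) :
    embed i (dysonProd a) = ∏ p ∈ pairs n,
      qPoch (ratio (i.succAbove p.1) (i.succAbove p.2)) (a p.1) *
        qPoch (algebraMap K (Laurent (n + 1)) q * ratio (i.succAbove p.2) (i.succAbove p.1))
          (a p.2) := by
  simp only [dysonProd, map_prod, map_mul, map_qPoch, embed_ratio, AlgHom.commutes]

/-- Polynomials in `x_i` whose coefficients are Laurent polynomials in the other variables. -/
noncomputable def polyEmbed {n : ℕ} (i : Fin (n + 1)) :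
    Polynomial (Laurent n) →ₐ[K] Laurent (n + 1) :=
  Polynomial.eval₂AlgHom (embed i) (mono (Pi.single i 1)) fun _ => Commute.all _ _

@[simp] theorem polyEmbed_C {n : ℕ} (i : Fin (n + 1)) (g : Laurent n) :
    polyEmbed i (Polynomial.C g) = embed i g := Polynomial.eval₂_C _ _

@[simp] theorem polyEmbed_X {n : ℕ} (i : Fin (n + 1)) :
    polyEmbed i Polynomial.X = mono (Pi.single i 1) := Polynomial.eval₂_X _ _

/-- The specialization `x_i = 0`. -/
noncomputable def evalZero (n : ℕ) : Polynomial (Laurent n) →ₐ[K] Laurent n :=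
  (Polynomial.aeval (0 : Laurent n)).restrictScalars K

theorem evalZero_eq_coeff {n : ℕ} (p : Polynomial (Laurent n)) : evalZero n p = p.coeff 0 := by
  simp [evalZero, Polynomial.coeff_zero_eq_aeval_zero]

@[simp] theorem evalZero_C {n : ℕ} (g : Laurent n) : evalZero n (Polynomial.C g) = g := by
  simp [evalZero_eq_coeff]

@[simp] theorem evalZero_X {n : ℕ} : evalZero n Polynomial.X = 0 := by
  simp [evalZero_eq_coeff]

/-! ### Constant terms -/

theorem CT_add {n : ℕ} (f g : Laurent n) : CT (f + g) = CT f + CT g := by simp [CT]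

theorem CT_sum {n : ℕ} {ι : Type*} (s : Finset ι) (f : ι → Laurent n) :
    CT (∑ i ∈ s, f i) = ∑ i ∈ s, CT (f i) := by simp [CT]

theorem CT_algebraMap_mul {n : ℕ} (c : K) (f : Laurent n) :
    CT (algebraMap K (Laurent n) c * f) = c * CT f := by
  rw [← Algebra.smul_def]
  simp [CT]

theorem CT_single {n : ℕ} (u : Fin n → ℤ) (c : K) :
    CT (AddMonoidAlgebra.single u c : Laurent n) = if u = 0 then c else 0 := by
  simp [CT, Finsupp.single_apply]

/-- A monomial of degree `t` in `x_i` ends up with exponent `r + t - v_i`, and since `v_i ≤ r` this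
is zero only for `t = 0` and `r = v_i`. -/
theorem CT_mono_mul_polyEmbed {n : ℕ} (i : Fin (n + 1)) (v : Fin (n + 1) → ℕ) (r : ℕ)
    (hr : v i ≤ r) (p : Polynomial (Laurent n)) :
    CT (mono (fun j => -(v j : ℤ)) * (mono (Pi.single i 1) ^ r * polyEmbed i p)) =
      if v i = r then CT (mono (fun j => -(v (i.succAbove j) : ℤ)) * evalZero n p) else 0 := by
  induction p using Polynomial.induction_on' with
  | add p g hp hg =>
    simp only [map_add, mul_add, CT_add, hp, hg]
    split_ifs <;> simp
  | monomial t g =>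
    induction g using AddMonoidAlgebra.induction_linear with
    | zero => simp [CT]
    | add g h hg hh =>
      simp only [map_add, mul_add, CT_add, hg, hh]
      split_ifs <;> simp
    | single u c =>
      rw [← Polynomial.C_mul_X_pow_eq_monomial, map_mul, map_mul, map_pow, map_pow, polyEmbed_C,
        polyEmbed_X, evalZero_C, evalZero_X, embed_single, mul_left_comm (mono _ ^ r), ← pow_add,
        mono_pow, mono, mono, mono, AddMonoidAlgebra.single_mul_single,
        AddMonoidAlgebra.single_mul_single, CT_single]
      have h0 : ((fun j => -(v j : ℤ)) +
          (insertZero i u + (r + t) • (Pi.single i 1 : Fin (n + 1) → ℤ)) = 0) ↔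
          (v i = r ∧ t = 0) ∧ (fun j => -(v (i.succAbove j) : ℤ)) + u = 0 := by
        constructor
        · intro h
          have hi := congrFun h i
          rw [Pi.add_apply, Pi.add_apply, Pi.smul_apply] at hi
          simp only [insertZero_apply_same, Pi.single_eq_same, mul_one, Pi.zero_apply, zero_add,
            Nat.cast_add, nsmul_eq_mul] at hi
          refine ⟨by omega, ?_⟩
          ext j
          have hj := congrFun h (i.succAbove j)
          simpa [i.succAbove_ne j] using hj
        · rintro ⟨⟨h1, rfl⟩, h2⟩
          ext j
          refine Fin.succAboveCases i ?_ (fun j => ?_) j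
          · simp [h1]
          · simpa [i.succAbove_ne j] using congrFun h2 j
      rw [if_congr h0 rfl rfl]
      by_cases h1 : v i = r
      · by_cases h2 : t = 0
        · simp only [h1, h2, pow_zero, mul_one, and_self, true_and, if_true,
            AddMonoidAlgebra.single_mul_single, CT_single, one_mul]
        · simp [h2, CT]
      · simp [h1]

/-! ### The alphabet -/

/-- The alphabet `(x_i q ^ k)`, indexed by pairs `(i, k)` with `k < a_i`. -/
noncomputable def letter {n : ℕ} (a : Fin n → ℕ) (s : Σ i, Fin (a i)) : Laurent n :=
  mono (Pi.single s.1 1) * algebraMap K (Laurent n) (q ^ (s.2 : ℕ))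

theorem letter_eq_single {n : ℕ} (a : Fin n → ℕ) (s : Σ i, Fin (a i)) :
    letter a s = AddMonoidAlgebra.single (Pi.single s.1 1) (q ^ (s.2 : ℕ)) := by
  rw [letter, mul_comm, algebraMap_mul_mono]

theorem letter_injective {n : ℕ} (a : Fin n → ℕ) : Function.Injective (letter a) := by
  rintro ⟨i, k⟩ ⟨j, l⟩ h
  rw [letter_eq_single, letter_eq_single, AddMonoidAlgebra.single_inj] at h
  rcases h with ⟨h1, h2⟩ | ⟨h1, -⟩
  · obtain rfl : i = j := by
      by_contra hij
      have := congrFun h1 i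
      simp [hij] at this
    obtain rfl : k = l := Fin.ext (q_pow_injective h2)
    rfl
  · exact absurd h1 (pow_ne_zero _ q_ne_zero)

theorem D₂_pad_eq {n m : ℕ} (v a : Fin n → ℕ) (lam : Fin m → ℕ) :
    D₂ v a (pad (∑ i, a i) lam) =
      CT (mono (fun i => -(v i : ℤ)) * (dysonProd a * schurEval lam (letter a))) := by
  rw [schurEval_eq_aeval lam (letter a) finSigmaFinEquiv.symm, D₂, mul_assoc,
    mul_comm (dysonProd a)]
  congr 3
  -- The two sides need not use the same `ℤ`-algebra structure on `Laurent n`; the identity ring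
  -- homomorphism carries one evaluation to the other.
  exact @map_aeval_int _ _ _ _ _ _ (Ring.toIntAlgebra _) _ _ _ (RingHom.id (Laurent n))
    (alphabet a) _

/-- The alphabet as a family of polynomials in `x_i`. -/
noncomputable def polyLetter {n : ℕ} (i : Fin (n + 1)) (a : Fin (n + 1) → ℕ)
    (s : Σ i, Fin (a i)) : Polynomial (Laurent n) :=
  i.insertNth (α := fun _ => Polynomial (Laurent n)) Polynomial.X
    (fun j => Polynomial.C (mono (Pi.single j 1))) s.1 * algebraMap K _ (q ^ (s.2 : ℕ))

theorem polyEmbed_polyLetter {n : ℕ} (i : Fin (n + 1)) (a : Fin (n + 1) → ℕ)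
    (s : Σ i, Fin (a i)) : polyEmbed i (polyLetter i a s) = letter a s := by
  obtain ⟨j, k⟩ := s
  rw [polyLetter, letter, map_mul, AlgHom.commutes]
  congr 1
  dsimp only
  refine Fin.succAboveCases i ?_ (fun j => ?_) j
  · rw [Fin.insertNth_apply_same, polyEmbed_X]
  · rw [Fin.insertNth_apply_succAbove, polyEmbed_C, embed_mono, insertZero_single]

theorem evalZero_polyLetter_same {n : ℕ} (i : Fin (n + 1)) (a : Fin (n + 1) → ℕ)
    (k : Fin (a i)) : evalZero n (polyLetter i a ⟨i, k⟩) = 0 := by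
  rw [polyLetter, map_mul, Fin.insertNth_apply_same, evalZero_X, zero_mul]

theorem evalZero_polyLetter_succAbove {n : ℕ} (i : Fin (n + 1)) (a : Fin (n + 1) → ℕ)
    (j : Fin n) (k : Fin (a (i.succAbove j))) :
    evalZero n (polyLetter i a ⟨i.succAbove j, k⟩) = letter (a ∘ i.succAbove) ⟨j, k⟩ := by
  rw [polyLetter, map_mul, Fin.insertNth_apply_succAbove, evalZero_C, AlgHom.commutes, letter]

/-- At `x_i = 0` the remaining letters `x_i q^l` vanish and can be dropped. The bound on `m` ensures
that enough letters are left for all parts of `lam`. -/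
theorem evalZero_schurEval {n m : ℕ} (i : Fin (n + 1)) (a : Fin (n + 1) → ℕ)
    (hm : m ≤ ∑ j, a (i.succAbove j)) (lam : Fin m → ℕ) (k : Fin (a i)) :
    evalZero n (schurEval lam fun s : {s : Σ i, Fin (a i) // s ≠ ⟨i, k⟩} => polyLetter i a s) =
      schurEval lam (letter (a ∘ i.succAbove)) := by
  let f : (Σ j, Fin ((a ∘ i.succAbove) j)) ↪ {s : Σ i, Fin (a i) // s ≠ ⟨i, k⟩} :=
    ⟨fun s => ⟨⟨i.succAbove s.1, s.2⟩, fun h => i.succAbove_ne s.1 (congrArg Sigma.fst h)⟩, by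
      rintro ⟨j, l⟩ ⟨j', l'⟩ h
      have h' := Sigma.mk.inj_iff.mp (congrArg Subtype.val h)
      obtain rfl := i.succAbove_right_injective h'.1
      obtain rfl := eq_of_heq h'.2
      rfl⟩
  rw [map_schurEval, schurEval_of_eq_zero lam _ f]
  · congr 1
    ext1 ⟨j, l⟩
    exact evalZero_polyLetter_succAbove i a j l
  · rintro ⟨⟨j, l⟩, hs⟩ hr
    revert l
    refine Fin.succAboveCases i (fun l hs hr => ?_) (fun j l hs hr => ?_) j
    · exact evalZero_polyLetter_same i a l
    · exact absurd ⟨⟨j, l⟩, rfl⟩ hr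
  · simpa using hm

/-! ### Division of the `q`-Dyson product -/

open Polynomial in
-- Homogenization of `exists_dyson_factor` at `u = x/y`, with `u' = y/x`: multiplying by `y ^ b`
-- clears the denominators.
theorem aeval_mul_prod_sub {A : Type*} [CommRing A] [Algebra K A] {a b k ε : ℕ} {f : K[X]}
    (hf : f * ∏ l ∈ Finset.range b, (C (q ^ k) * X - C (q ^ l)) =
      C (q ^ (k * b)) * (∏ m ∈ Finset.range a, (1 - C (q ^ (1 - ε + m)) * X)) *
        ∏ l ∈ Finset.range b, (X - C (q ^ (ε + l))))
    {x y u u' : A} (hu : y * u = x) (hu' : x * u' = y) :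
    aeval u f * ∏ l ∈ Finset.range b, (x * algebraMap K A (q ^ k) - y * algebraMap K A (q ^ l)) =
      (x * algebraMap K A (q ^ k)) ^ b *
        ((∏ m ∈ Finset.range a, (1 - algebraMap K A (q ^ (1 - ε + m)) * u)) *
          ∏ l ∈ Finset.range b, (1 - algebraMap K A (q ^ (ε + l)) * u')) := by
  have h := congrArg (aeval u) hf
  simp only [map_mul, map_prod, map_sub, map_one, aeval_C, aeval_X] at h
  have hpow (z : A) : z ^ b = ∏ _l ∈ Finset.range b, z := by simp
  have h1 : ∏ l ∈ Finset.range b, (x * algebraMap K A (q ^ k) - y * algebraMap K A (q ^ l)) =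
      y ^ b * ∏ l ∈ Finset.range b, (algebraMap K A (q ^ k) * u - algebraMap K A (q ^ l)) := by
    rw [hpow y, ← Finset.prod_mul_distrib]
    exact Finset.prod_congr rfl fun l _ => by rw [← hu]; ring
  have h2 : y ^ b * ∏ l ∈ Finset.range b, (u - algebraMap K A (q ^ (ε + l))) =
      x ^ b * ∏ l ∈ Finset.range b, (1 - algebraMap K A (q ^ (ε + l)) * u') := by
    rw [hpow y, hpow x,
      ← Finset.prod_mul_distrib, ← Finset.prod_mul_distrib]
    refine Finset.prod_congr rfl fun l _ => ?_
    linear_combination hu + algebraMap K A (q ^ (ε + l)) * hu'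
  rw [h1, mul_left_comm, h, mul_pow, ← map_pow, ← pow_mul]
  linear_combination (algebraMap K A (q ^ (k * b)) *
    (∏ m ∈ Finset.range a, (1 - algebraMap K A (q ^ (1 - ε + m)) * u))) * h2

theorem ratio_mul_right {n : ℕ} (i j : Fin n) :
    mono (Pi.single j 1) * ratio i j = mono (Pi.single i 1) := by
  rw [ratio, ← mono_add, add_sub_cancel]

/-- The factor of the `q`-Dyson product that belongs to the variables `x_i` and `x_j`. -/
noncomputable def pairFactor {n : ℕ} (a : Fin n → ℕ) (i j : Fin n) : Laurent n :=
  qPoch (ratio i j) (a i) * qPoch (algebraMap K (Laurent n) q * ratio j i) (a j)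

theorem dysonProd_succAbove {n : ℕ} (a : Fin (n + 1) → ℕ) (i : Fin (n + 1)) :
    dysonProd a = (∏ j, if i < i.succAbove j then pairFactor a i (i.succAbove j)
      else pairFactor a (i.succAbove j) i) * embed i (dysonProd (a ∘ i.succAbove)) := by
  rw [embed_dysonProd]
  exact prod_pairs_succAbove i (pairFactor a)

/-- With `ε = 1` for `x_i` to the left of the other variable and `ε = 0` otherwise, the shifts `1 -
ε` and `ε` of `exists_dyson_factor` record which of the two `q`-shifted factorials carries the extra
`q`. -/
theorem exists_pair_quotient {n : ℕ} (a : Fin (n + 1) → ℕ) (i : Fin (n + 1)) (k : Fin (a i))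
    (j : Fin n) :
    ∃ F : Polynomial (Laurent n),
      polyEmbed i F * ∏ l, (letter a ⟨i, k⟩ - letter a ⟨i.succAbove j, l⟩) =
        letter a ⟨i, k⟩ ^ a (i.succAbove j) *
          (if i < i.succAbove j then pairFactor a i (i.succAbove j)
            else pairFactor a (i.succAbove j) i) ∧
      evalZero n F = algebraMap K _
        (q ^ (((k : ℕ) + if i < i.succAbove j then 1 else 0) * a (i.succAbove j))) := by
  have hε : (if i < i.succAbove j then 1 else 0) ≤ 1 := by split_ifs <;> simp
  obtain ⟨f, hf, hf0⟩ := exists_dyson_factor (a i) (a (i.succAbove j)) k _ k.isLt hε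
  refine ⟨Polynomial.aeval (Polynomial.C (mono (-Pi.single j 1)) * Polynomial.X) f, ?_, ?_⟩
  · have hr : polyEmbed i (Polynomial.C (mono (-Pi.single j 1)) * Polynomial.X) =
        ratio i (i.succAbove j) := by
      rw [map_mul, polyEmbed_C, polyEmbed_X, embed_mono, map_neg, insertZero_single, ← mono_add,
        ratio, neg_add_eq_sub]
    rw [← Polynomial.aeval_algHom_apply, hr]
    have h := aeval_mul_prod_sub hf (ratio_mul_right i (i.succAbove j))
      (ratio_mul_right (i.succAbove j) i)
    rw [← Fin.prod_univ_eq_prod_range (fun l => mono (Pi.single i 1) *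
      algebraMap K (Laurent (n + 1)) (q ^ (k : ℕ)) - mono (Pi.single (i.succAbove j) 1) *
        algebraMap K _ (q ^ l))] at h
    refine h.trans ?_
    congr 1
    split_ifs with hij
    · simp [pairFactor, qPoch, pow_add, mul_comm, mul_left_comm]
    · simp [pairFactor, qPoch, pow_add, mul_comm, mul_left_comm]
  · rw [← Polynomial.aeval_algHom_apply, map_mul, evalZero_X, mul_zero,
      ← Polynomial.coeff_zero_eq_aeval_zero', hf0]

/-- The `q`-Dyson product divided by a factor of the Vandermonde product of the alphabet is
polynomial in `x_i`. -/
theorem exists_quotient {n : ℕ} (a : Fin (n + 1) → ℕ) (i : Fin (n + 1)) (k : Fin (a i)) :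
    ∃ B : Polynomial (Laurent n),
      polyEmbed i B * ∏ s : {s : Σ i, Fin (a i) // s ≠ ⟨i, k⟩},
        (letter a ⟨i, k⟩ - letter a s) =
          dysonProd a * letter a ⟨i, k⟩ ^ (Fintype.card (Σ i, Fin (a i)) - 1) ∧
      evalZero n B = algebraMap K _
        ((q ^ (k : ℕ)) ^ (a i - 1) /
            (∏ l ∈ Finset.range (a i), if l = k then 1 else q ^ (k : ℕ) - q ^ l) *
          ∏ j, q ^ (((k : ℕ) + if i < i.succAbove j then 1 else 0) * a (i.succAbove j))) *
        dysonProd (a ∘ i.succAbove) := by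
  choose F hF hF0 using exists_pair_quotient a i k
  set d : K := ∏ l ∈ Finset.range (a i), if l = (k : ℕ) then 1 else q ^ (k : ℕ) - q ^ l with hd
  have hd0 : d ≠ 0 := by
    refine Finset.prod_ne_zero_iff.mpr fun l _ => ?_
    split_ifs with h
    · exact one_ne_zero
    · exact sub_ne_zero.mpr (q_pow_injective.ne (Ne.symm h))
  -- The other letters of `x_i` contribute the denominator `x_i^(a_i-1) * d`, which absorbs `a_i -
  -- 1` of the powers of the letter; each other variable contributes one `F j`, and the Dyson
  -- factors without `x_i` are untouched.
  refine ⟨algebraMap K _ ((q ^ (k : ℕ)) ^ (a i - 1) / d) * (∏ j, F j) *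
    Polynomial.C (dysonProd (a ∘ i.succAbove)), ?_, ?_⟩
  · have h1 : ∏ s : {s : Σ i, Fin (a i) // s ≠ ⟨i, k⟩}, (letter a ⟨i, k⟩ - letter a s) =
        (mono (Pi.single i 1) ^ (a i - 1) * algebraMap K _ d) *
          ∏ j, ∏ l, (letter a ⟨i, k⟩ - letter a ⟨i.succAbove j, l⟩) := by
      have h2 : ∏ s : {s : Σ i, Fin (a i) // s ≠ ⟨i, k⟩}, (letter a ⟨i, k⟩ - letter a s) =
          ∏ s : Σ i, Fin (a i), if s ≠ ⟨i, k⟩ then letter a ⟨i, k⟩ - letter a s else 1 := by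
        rw [← Finset.prod_filter]
        exact (Finset.prod_subtype _ (by simp) fun s => letter a ⟨i, k⟩ - letter a s).symm
      rw [h2, Fintype.prod_sigma, Fin.prod_univ_succAbove _ i]
      congr 1
      · have hd' : d = ∏ l : Fin (a i), if l = k then 1 else q ^ (k : ℕ) - q ^ (l : ℕ) := by
          rw [hd, ← Fin.prod_univ_eq_prod_range
            (fun l => if l = (k : ℕ) then 1 else q ^ (k : ℕ) - q ^ l)]
          simp only [Fin.ext_iff]
        rw [hd', ← Finset.mul_prod_erase _ _ (Finset.mem_univ k),
          ← Finset.mul_prod_erase _ (fun l => if l = k then 1 else q ^ (k : ℕ) - q ^ (l : ℕ))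
            (Finset.mem_univ k)]
        simp only [ne_eq, not_true_eq_false, if_false, if_true, one_mul]
        have hm : (mono (Pi.single i 1) : Laurent (n + 1)) ^ (a i - 1) =
            ∏ _l ∈ Finset.univ.erase k, mono (Pi.single i 1) := by
          rw [Finset.prod_const, Finset.card_erase_of_mem (Finset.mem_univ k), Finset.card_univ,
            Fintype.card_fin]
        rw [hm, map_prod, ← Finset.prod_mul_distrib]
        refine Finset.prod_congr rfl fun l hl => ?_
        have hlk := Finset.ne_of_mem_erase hl
        have hlk' : (⟨i, l⟩ : Σ i, Fin (a i)) ≠ ⟨i, k⟩ := fun h => hlk (by simpa using h)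
        rw [if_pos hlk', if_neg hlk, letter, letter, map_sub, mul_sub]
      · refine Finset.prod_congr rfl fun j _ => Finset.prod_congr rfl fun l _ => ?_
        rw [if_pos]
        exact fun h => i.succAbove_ne j (congrArg Sigma.fst h)
    have hcard : Fintype.card (Σ i, Fin (a i)) - 1 = (a i - 1) + ∑ j, a (i.succAbove j) := by
      rw [Fintype.card_sigma]
      simp only [Fintype.card_fin]
      rw [Fin.sum_univ_succAbove _ i]
      have := k.pos
      omega
    have h3 : (∏ j, polyEmbed i (F j)) *
        ∏ j, ∏ l, (letter a ⟨i, k⟩ - letter a ⟨i.succAbove j, l⟩) =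
        letter a ⟨i, k⟩ ^ (∑ j, a (i.succAbove j)) *
          ∏ j, (if i < i.succAbove j then pairFactor a i (i.succAbove j)
            else pairFactor a (i.succAbove j) i) := by
      rw [← Finset.prod_mul_distrib, ← Finset.prod_pow_eq_pow_sum, ← Finset.prod_mul_distrib]
      exact Finset.prod_congr rfl fun j _ => hF j
    have h4 : algebraMap K (Laurent (n + 1)) ((q ^ (k : ℕ)) ^ (a i - 1) / d) *
        (mono (Pi.single i 1) ^ (a i - 1) * algebraMap K _ d) =
        letter a ⟨i, k⟩ ^ (a i - 1) := by
      rw [mul_left_comm, ← map_mul, div_mul_cancel₀ _ hd0, letter, mul_pow, map_pow]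
    rw [h1, hcard, dysonProd_succAbove a i, map_mul, map_mul, map_prod, polyEmbed_C,
      AlgHom.commutes, pow_add, ← h4]
    linear_combination (algebraMap K (Laurent (n + 1)) ((q ^ (k : ℕ)) ^ (a i - 1) / d) *
        (mono (Pi.single i 1) ^ (a i - 1) * algebraMap K _ d) *
        embed i (dysonProd (a ∘ i.succAbove))) * h3
  · rw [map_mul, map_mul, map_prod, evalZero_C, AlgHom.commutes, map_mul (algebraMap K _),
      map_prod (algebraMap K _)]
    simp only [hF0]

/-- The recursion that removes the largest entry `v_i` of `v`, provided that it occurs only once. -/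
theorem D₂_eq_of_unique_max {n : ℕ} (a : Fin (n + 1) → ℕ) (ha : ∀ i, 0 < a i)
    (v lam : Fin (n + 1) → ℕ) (i : Fin (n + 1)) (hi : lam 0 = v i)
    (hv : ∀ j, j ≠ i → v j < v i) :
    D₂ v a (pad (∑ i, a i) lam) =
      q ^ (∑ j, if i < i.succAbove j then a (i.succAbove j) else 0) *
        qbin (v i + ∑ i, a i - 1) (a i - 1) *
        D₂ (v ∘ i.succAbove) (a ∘ i.succAbove)
          (pad (∑ j, (a ∘ i.succAbove) j) (lam ∘ Fin.succ)) := by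
  classical
  choose B hB hB0 using exists_quotient a
  have : Nonempty (Σ i, Fin (a i)) := ⟨⟨i, ⟨0, ha i⟩⟩⟩
  set E := CT (mono (fun j => -(v (i.succAbove j) : ℤ)) *
    (dysonProd (a ∘ i.succAbove) * schurEval (lam ∘ Fin.succ) (letter (a ∘ i.succAbove)))) with hE
  have hterm : ∀ (j : Fin (n + 1)) (k : Fin (a j)),
      letter a ⟨j, k⟩ ^ lam 0 * schurEval (lam ∘ Fin.succ)
        (fun s : {s : Σ i, Fin (a i) // s ≠ ⟨j, k⟩} => letter a s) * polyEmbed j (B j k) =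
      mono (Pi.single j 1) ^ lam 0 * polyEmbed j (algebraMap K _ ((q ^ (k : ℕ)) ^ lam 0) *
        schurEval (lam ∘ Fin.succ)
          (fun s : {s : Σ i, Fin (a i) // s ≠ ⟨j, k⟩} => polyLetter j a s) * B j k) := by
    intro j k
    simp only [map_mul, map_schurEval, polyEmbed_polyLetter, AlgHom.commutes]
    rw [letter, mul_pow, ← map_pow]
    simp only [mul_assoc]
  rw [D₂_pad_eq, D₂_pad_eq, mul_schurEval_eq_sum lam (letter_injective a) (dysonProd a)
    (fun s => polyEmbed s.1 (B s.1 s.2)) (fun s => hB s.1 s.2), Finset.mul_sum, CT_sum,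
    Fintype.sum_sigma, Finset.sum_eq_single i]
  · have hk : ∀ k : Fin (a i), CT (mono (fun j => -(v j : ℤ)) * (letter a ⟨i, k⟩ ^ lam 0 *
        schurEval (lam ∘ Fin.succ)
          (fun s : {s : Σ i, Fin (a i) // s ≠ ⟨i, k⟩} => letter a s) * polyEmbed i (B i k))) =
        (q ^ (k : ℕ)) ^ (v i + ∑ i, a i - 1) /
            (∏ l ∈ Finset.range (a i), if l = (k : ℕ) then 1 else q ^ (k : ℕ) - q ^ l) *
          (q ^ (∑ j, if i < i.succAbove j then a (i.succAbove j) else 0) * E) := by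
      intro k
      rw [hterm, CT_mono_mul_polyEmbed i v _ hi.ge, if_pos hi.symm, map_mul, map_mul,
        AlgHom.commutes, evalZero_schurEval, hB0]
      · rw [mul_assoc (algebraMap K _ ((q ^ (k : ℕ)) ^ lam 0)), mul_left_comm (mono _),
          CT_algebraMap_mul, mul_left_comm (schurEval _ _), mul_left_comm (mono _),
          CT_algebraMap_mul, mul_comm (schurEval _ _), ← hE, Finset.prod_pow_eq_pow_sum]
        have hsum : ∑ j, ((k : ℕ) + if i < i.succAbove j then 1 else 0) * a (i.succAbove j) =
            k * (∑ j, a (i.succAbove j)) +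
              ∑ j, if i < i.succAbove j then a (i.succAbove j) else 0 := by
          rw [Finset.mul_sum, ← Finset.sum_add_distrib]
          refine Finset.sum_congr rfl fun j _ => ?_
          split_ifs <;> ring
        -- The powers of `q^k` come from `lam 0`, from the other letters of `x_i`, and from the
        -- values of the pair quotients at `x_i = 0`.
        have hexp : v i + ∑ i, a i - 1 = lam 0 + (a i - 1) + ∑ j, a (i.succAbove j) := by
          rw [Fin.sum_univ_succAbove _ i]
          have := ha i
          omega
        rw [hsum, hexp, pow_add, pow_mul, pow_add (q ^ (k : ℕ)), pow_add (q ^ (k : ℕ))]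
        ring
      · calc n = ∑ _j : Fin n, 1 := by simp
          _ ≤ _ := Finset.sum_le_sum fun j _ => ha _
    refine (Finset.sum_congr rfl fun k _ => hk k).trans ?_
    rw [← Finset.sum_mul]
    obtain ⟨m, hm⟩ : ∃ m, a i = m + 1 := Nat.exists_eq_succ_of_ne_zero (ha i).ne'
    have hs := sum_pow_div_prod_sub m (v i + ∑ i, a i - 1) (by
      have := Finset.single_le_sum (f := a) (fun _ _ => Nat.zero_le _) (Finset.mem_univ i)
      omega)
    rw [← hm, ← Fin.sum_univ_eq_sum_range (fun k => (q ^ k) ^ (v i + ∑ i, a i - 1) /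
      ∏ l ∈ Finset.range (a i), if l = k then 1 else q ^ k - q ^ l)] at hs
    rw [hs, hm, Nat.add_sub_cancel]
    simp only [hE, Function.comp_apply]
    ring
  -- For `j ≠ i` the term has order at least `lam 0 = v i > v j` in `x_j`, so it has no constant
  -- term.
  · intro j _ hj
    refine Finset.sum_eq_zero fun k _ => ?_
    have := hv j hj
    rw [hterm, CT_mono_mul_polyEmbed j v _ (by omega), if_neg (by omega)]
  · simp

/-! ### Permutations -/

theorem dominant_permute {n : ℕ} {lam : Fin n → ℕ} (h : Antitone lam) (w : Equiv.Perm (Fin n)) :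
    dominant (permute w (bar lam)) = lam := by
  have hm : Monotone (bar lam) := fun i j hij => h (Fin.rev_le_rev.mpr hij)
  have h1 : permute w (bar lam) ∘ Tuple.sort (permute w (bar lam)) = bar lam := by
    have := Tuple.comp_sort_eq_comp_iff_monotone (f := permute w (bar lam)) (σ := w⁻¹)
    have hw : permute w (bar lam) ∘ (w⁻¹ : Equiv.Perm (Fin n)) = bar lam := by
      ext i
      simp [permute]
    rw [hw] at this
    exact (this.mpr hm).symm
  ext i
  have := congrFun h1 i.rev
  simpa [bar, dominant] using this

/-- Indexing by the positions `s`, `t` of the two values in the word of `w` lets the last position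
be split off. -/
theorem sum_R_eq {n : ℕ} (w : Equiv.Perm (Fin n)) (a : Fin n → ℕ) :
    ∑ p ∈ R w, a p.2 = ∑ s, ∑ t, if t < s ∧ w s < w t then a (w t) else 0 := by
  rw [R, inversionSet, pairs, Finset.filter_filter, Finset.sum_filter, ← Finset.univ_product_univ,
    Finset.sum_product, ← Equiv.sum_comp w]
  refine Finset.sum_congr rfl fun s _ => ?_
  rw [← Equiv.sum_comp w]
  simp [and_comm]

/-- The permutation obtained from `w` by deleting its last entry. -/
theorem exists_perm_succAbove {n : ℕ} (w : Equiv.Perm (Fin (n + 1))) :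
    ∃ w' : Equiv.Perm (Fin n), ∀ j, w j.castSucc = (w (Fin.last n)).succAbove (w' j) := by
  have h : ∀ j : Fin n, ∃ k, (w (Fin.last n)).succAbove k = w j.castSucc := fun j =>
    Fin.exists_succAbove_eq (w.injective.ne (Fin.castSucc_lt_last j).ne)
  choose f hf using h
  have hinj : Function.Injective f := fun j k hjk => by
    have : w j.castSucc = w k.castSucc := by rw [← hf, ← hf, hjk]
    simpa using this
  exact ⟨Equiv.ofBijective f (Finite.injective_iff_bijective.mp hinj), fun j => (hf j).symm⟩

/-- Induction on `n`: the unique maximum `lam 0` of `w⁻¹(bar lam)` sits at `i = w(n)`, and removing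
it deletes the last entry of the word of `w`. Since `i` comes last, the pairs of `R w` containing it
are exactly `(i, j)` with `i < j`, which matches the power of `q` in the recursion. -/
theorem D₂_permute_bar : ∀ (n : ℕ) (lam : Fin n → ℕ), StrictAnti lam → ∀ a : Fin n → ℕ,
    (∀ i, 0 < a i) → ∀ w : Equiv.Perm (Fin n),
    D₂ (permute w⁻¹ (bar lam)) a (pad (∑ i, a i) lam) =
      (∏ i, qbin (bar lam i + partialSum (permute w a) i - 1) (permute w a i - 1)) *
        q ^ (∑ p ∈ R w, a p.2) := by
  intro n
  induction n with
  | zero =>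
    intro lam _ a _ w
    have h1 : (mono fun i => -(permute w⁻¹ (bar lam) i : ℤ)) = (1 : Laurent 0) := by
      rw [← mono_zero]
      congr 1
      exact Subsingleton.elim _ _
    rw [D₂_pad_eq, h1, schurEval_of_isEmpty]
    simp [dysonProd, pairs, R, inversionSet, ← mono_zero, mono, CT]
  | succ n ih =>
    intro lam hlam a ha w
    obtain ⟨w', hw'⟩ := exists_perm_succAbove w
    set i := w (Fin.last n) with hi
    have hvi : permute w⁻¹ (bar lam) i = lam 0 := by simp [permute, bar, hi]
    have hvs : permute w⁻¹ (bar lam) ∘ i.succAbove = permute w'⁻¹ (bar (lam ∘ Fin.succ)) := by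
      ext j
      obtain ⟨j, rfl⟩ := w'.surjective j
      simp [permute, bar, ← hw', Fin.rev_castSucc]
    rw [D₂_eq_of_unique_max a ha _ lam i hvi.symm, hvs,
      ih (lam ∘ Fin.succ) (hlam.comp_strictMono Fin.strictMono_succ) (a ∘ i.succAbove)
        (fun j => ha _) w', hvi,
      Fin.prod_univ_castSucc]
    · have hlast : partialSum (permute w a) (Fin.last n) = ∑ i, a i := by
        rw [partialSum, ← Fin.top_eq_last, Finset.Iic_top]
        exact Equiv.sum_comp w a
      have hpart : ∀ j : Fin n, partialSum (permute w a) j.castSucc =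
          partialSum (permute w' (a ∘ i.succAbove)) j := by
        intro j
        rw [partialSum, partialSum, ← Fin.map_castSuccEmb_Iic, Finset.sum_map]
        exact Finset.sum_congr rfl fun k _ => by simp [permute, hw']
      have hR : ∑ p ∈ R w, a p.2 = (∑ j, if i < i.succAbove j then a (i.succAbove j) else 0) +
          ∑ p ∈ R w', (a ∘ i.succAbove) p.2 := by
        rw [sum_R_eq, sum_R_eq, Fin.sum_univ_castSucc, add_comm]
        congr 1
        · rw [Fin.sum_univ_castSucc, ← Equiv.sum_comp w' fun j => if i < i.succAbove j then _ else _]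
          simp [hw', ← hi, Fin.castSucc_lt_last]
        · refine Finset.sum_congr rfl fun s _ => ?_
          rw [Fin.sum_univ_castSucc]
          simp [hw', (Fin.castSucc_lt_last s).not_gt]
      rw [hR, hlast, pow_add]
      simp only [hpart]
      have hbar : bar lam (Fin.last n) = lam 0 := by simp [bar]
      have hbar' : ∀ j : Fin n, bar lam j.castSucc = bar (lam ∘ Fin.succ) j := fun j => by
        simp [bar, Fin.rev_castSucc]
      have hperm : ∀ j : Fin n, permute w a j.castSucc = permute w' (a ∘ i.succAbove) j :=
        fun j => by simp [permute, hw']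
      have hpi : permute w a (Fin.last n) = a i := rfl
      simp only [hbar, hbar', hperm, hpi]
      ring
    · intro j hj
      rw [hvi]
      apply hlam
      rw [Fin.pos_iff_ne_zero]
      intro h
      apply hj
      have : w⁻¹ j = Fin.last n := by rw [← Fin.rev_rev (w⁻¹ j), h, Fin.rev_zero]
      rw [hi, ← this]
      simp

end QDyson

theorem proposition4p7 (n : ℕ) (lam : Fin n → ℕ) (hlam : StrictAnti lam)
    (a : Fin n → ℕ) (ha : ∀ i, 0 < a i) :
    (∀ w : Equiv.Perm (Fin n),
      QDyson.D (QDyson.permute w⁻¹ (QDyson.bar lam)) a =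
        (∏ i, QDyson.qbin
          (QDyson.bar lam i + QDyson.partialSum (QDyson.permute w a) i - 1)
          (QDyson.permute w a i - 1)) *
        QDyson.q ^ (∑ p ∈ QDyson.R w, a p.2)) ∧
    QDyson.D₂ lam a (QDyson.pad (∑ i, a i) lam) =
      QDyson.q ^ (∑ p ∈ QDyson.pairs n, a p.2) *
        ∏ i, QDyson.qbin (lam i + (∑ j ∈ Finset.Ici i, a j) - 1) (a i - 1) := by
  refine ⟨fun w => ?_, ?_⟩
  · rw [QDyson.D, QDyson.dominant_permute hlam.antitone]
    exact QDyson.D₂_permute_bar n lam hlam a ha w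
  -- The reversal turns `bar lam` back into `lam`, and every pair lies in its `R`.
  · have h := QDyson.D₂_permute_bar n lam hlam a ha Fin.revPerm
    have h1 : QDyson.permute (Fin.revPerm : Equiv.Perm (Fin n))⁻¹ (QDyson.bar lam) = lam := by
      ext i
      simp [QDyson.permute, QDyson.bar, Equiv.Perm.inv_def]
    have h2 : QDyson.R (Fin.revPerm : Equiv.Perm (Fin n)) = QDyson.pairs n := by
      refine Finset.filter_true_of_mem fun p hp => ?_
      simpa [QDyson.pairs, Equiv.Perm.inv_def] using hp
    rw [h1, h2, mul_comm, ← Equiv.prod_comp Fin.revPerm] at h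
    rw [h]
    congr 1
    refine Finset.prod_congr rfl fun i _ => ?_
    have h3 : QDyson.partialSum (QDyson.permute Fin.revPerm a) (Fin.revPerm i) =
        ∑ j ∈ Finset.Ici i, a j := by
      rw [QDyson.partialSum, Fin.revPerm_apply, ← Fin.map_revPerm_Ici, Finset.sum_map]
      exact Finset.sum_congr rfl fun j _ => by simp [QDyson.permute]
    rw [h3]
    simp [QDyson.bar, QDyson.permute]
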